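/- Let $X\subset\mathbb{R}^d$ (Euclidean norm) satisfy $X\subset\overline{\operatorname{int}X}$, and let $A:=\overline{\mathbb{R}^d\setminus X}$ be its closed complement. For $S\subset\mathbb{R}^d$ let $d_S(y)=\inf_{s\in S}\|y-s\|$; the reach of $S$ is the supremum of all $t\ge 0$ such that every $y$ with $d_S(y)<t$ has a unique closest point in $S$. Write $\operatorname{Cone}B=\{\lambda b : \lambda\ge 0,\ b\in B\}$ and $B^{\mathrm{o}}=\{u : \langle u,b\rangle\le 0\ \ \forall b\in B\}$. The tangent cone $\operatorname{Tan}(A,x)$ is the cone generated by the limits of $(x_n-x)/\|x_n-x\|$ over sequences $x_n\in A\setminus\{x\}$ with $x_n\to x$. Suppose that $A$ has positive reach and is fully dimensional, i.e. for every $y\in\partial A$ the linear span of $\operatorname{Tan}(A,y)$ is $\mathbb{R}^d$. Let $x\in\partial A$. Define the normal cone of $X$ at $x$ by $\operatorname{Nor}(X,x):=-\operatorname{Nor}(A,x)$, where $\operatorname{Nor}(A,x)=\operatorname{Tan}(A,x)^{\mathrm{o}}$, and let $\partial^* d_X(x)$ denote the Clarke gradient of $d_X$ at $x$, i.e. the convex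 hull of all limits $\lim_i\nabla d_X(x_i)$ with $x_i\to x$ and $d_X$ differentiable at every $x_i$. Then $$\operatorname{Nor}(X,x)=\operatorname{Cone}\bigl(\partial^* d_X(x)\bigr).$$ -/

import Mathlib

open Filter Topology
open scoped Pointwise ENNReal

noncomputable section

namespace NormalClarke

variable {E : Type*} [NormedAddCommGroup E] [InnerProductSpace ℝ E]

/-- The closed complement of `X`: the closure of the set-theoretic complement. -/
def closedCompl (X : Set E) : Set E := closure Xᶜ

/-- The cone generated by `B`: the image of `[0, ∞) × B` under scalar multiplication. -/
def coneHull (B : Set E) : Set E := {v | ∃ t : ℝ, 0 ≤ t ∧ ∃ b ∈ B, v = t • b}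

/-- The polar (dual) cone of `B`: all `u` with `⟪u, b⟫ ≤ 0` for every `b ∈ B`. -/
def polarCone (B : Set E) : Set E := {u | ∀ b ∈ B, inner ℝ u b ≤ 0}

/-- The reach of `A`: the largest `t ∈ [0, ∞]` such that every point at distance less than `t`
from `A` has a unique closest point in `A`. -/
def reach (A : Set E) : ℝ≥0∞ :=
  sSup {t | ∀ y : E, Metric.infEDist y A < t → ∃! a, a ∈ A ∧ dist y a = Metric.infDist y A}

/-- The tangent cone of `A` at `x`: the cone generated by the limits of
`(y n - x) / ‖y n - x‖`, for sequences `y` in `A \ {x}` converging to `x`. -/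
def tangentCone (A : Set E) (x : E) : Set E :=
  coneHull {u | ∃ y : ℕ → E, (∀ n, y n ∈ A ∧ y n ≠ x) ∧ Tendsto y atTop (𝓝 x) ∧
    Tendsto (fun n => ‖y n - x‖⁻¹ • (y n - x)) atTop (𝓝 u)}

/-- The normal cone at `x` of a set `A` of positive reach: the polar of the tangent cone. -/
def normalCone (A : Set E) (x : E) : Set E := polarCone (tangentCone A x)

/-- The normal cone at `x` of a set `X` whose closed complement has positive reach and is fully
dimensional: the opposite of the normal cone of the closed complement. -/
def normalConeOfCompl (X : Set E) (x : E) : Set E := -normalCone (closedCompl X) x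

/-- `A` is fully dimensional: at each boundary point its tangent cone has the dimension of the
ambient space, the dimension of a cone being that of its linear span. -/
def FullyDimensional (A : Set E) : Prop :=
  ∀ x ∈ frontier A,
    Module.finrank ℝ (Submodule.span ℝ (tangentCone A x)) = Module.finrank ℝ E

/-- The Clarke gradient of `f` at `x`: the convex hull of all limits of gradients of `f` along
sequences of differentiability points of `f` converging to `x`. -/
def clarkeGradient [CompleteSpace E] (f : E → ℝ) (x : E) : Set E :=
  convexHull ℝ {v | ∃ y : ℕ → E, (∀ n, DifferentiableAt ℝ f (y n)) ∧ Tendsto y atTop (𝓝 x) ∧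
    Tendsto (fun n => gradient f (y n)) atTop (𝓝 v)}

end NormalClarke

end

/-!
Write `A` for the closed complement of `X` and `S` for the closure of `X`, and assume `x ∈ ∂A`. The
limits at `x` of gradients of `d_X = d_S` are `0` and the limits `v` of unit proximal normals of
`S`, so the Clarke gradient is the convex hull of `0` and these `v`.

*Such a `v` belongs to `Nor(X, x)`.* By Federer's theorem, a proximal normal of a set of reach
greater than `s` is realised by a ball of radius `s`; hence so is a limit of unit proximal normals,
and every boundary point of `A` carries such a normal. A ball outside `S` that touches `S` lies in
`A`, and the normal of `A` at the point of contact has to be opposite to that of `S`. Therefore `-v`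
is a limit of unit proximal normals of `A` and belongs to `Nor(A, x)`. As `Tan(A, x)` spans, there
is a vector having negative product with all nonzero elements of `Nor(A, x)`, so `0` is not in the
convex hull of the `v`.

*`Nor(X, x)` is contained in the cone generated by the `v`.* Otherwise some `u ∈ Nor(X, x)` admits
`w` with `⟪u, w⟫ > 0` and `⟪v, w⟫ < 0` for all `v`. Then `d_S` does not increase along directions
close to `w` near `x`, that is, `w` is hypertangent to `S` at `x`. Consequently `-w` is hypertangent
to the complement of `S`, which makes it tangent to `A`; this contradicts `⟪-u, -w⟫ > 0`,
since `-u ∈ Nor(A, x)`.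
-/

namespace NormalClarke

open Metric

section ProperMetricSpace

variable {α : Type*} [PseudoMetricSpace α] [ProperSpace α]

/- Maximise the perturbed function `f - c * dist · z` and let `c` tend to `1`. A maximiser inside
the ball would contradict steepness. -/
theorem exists_add_le_of_frequently_steep {f : α → ℝ} (hf : Continuous f) {z : α} {L : ℝ}
    (hL : 0 ≤ L)
    (hsteep : ∀ y, dist y z < L → f z ≤ f y → ∀ c < 1, ∃ᶠ y' in 𝓝 y, f y + c * dist y' y < f y') :
    ∃ y ∈ closedBall z L, f z + L ≤ f y := by
  have hcomp : IsCompact (closedBall z L) := isCompact_closedBall z L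
  have hz : z ∈ closedBall z L := mem_closedBall_self hL
  have almost : ∀ c ∈ Set.Ico (0 : ℝ) 1, ∃ y ∈ closedBall z L, f z + c * L ≤ f y := by
    intro c ⟨hc0, hc1⟩
    obtain ⟨y, hy, hmax⟩ := hcomp.exists_isMaxOn ⟨z, hz⟩ (f := fun y => f y - c * dist y z)
      (by fun_prop)
    have hzy : f z ≤ f y - c * dist y z := by simpa using hmax hz
    rcases (mem_closedBall.1 hy).lt_or_eq with hlt | heq
    · have hfy : f z ≤ f y := by nlinarith [dist_nonneg (x := y) (y := z)]
      have hnear : ∀ᶠ y' in 𝓝 y, dist y' z < L := isOpen_ball.mem_nhds hlt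
      obtain ⟨y', hsteep', hy'⟩ := ((hsteep y hlt hfy c hc1).and_eventually hnear).exists
      have hle : f y' - c * dist y' z ≤ f y - c * dist y z := hmax hy'.le
      nlinarith [dist_triangle y' y z]
    · exact ⟨y, hy, by rw [heq] at hzy; linarith⟩
  obtain ⟨y, hy, hmax⟩ := hcomp.exists_isMaxOn ⟨z, hz⟩ hf.continuousOn
  have hlim : Tendsto (fun c : ℝ => f z + c * L) (𝓝[<] 1) (𝓝 (f z + 1 * L)) :=
    Continuous.tendsto (by fun_prop) 1 |>.mono_left nhdsWithin_le_nhds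
  refine ⟨y, hy, one_mul L ▸ le_of_tendsto hlim ?_⟩
  filter_upwards [Ico_mem_nhdsLT zero_lt_one] with c hc
  obtain ⟨y', hy', h⟩ := almost c hc
  exact h.trans (hmax hy')

theorem eventually_closest_mem_of_unique {A : Set α} (hA : IsClosed A) {y p : α}
    (huniq : ∀ b ∈ A, dist y b = infDist y A → b = p) {U : Set α} (hU : U ∈ 𝓝 p) :
    ∀ᶠ z in 𝓝 y, ∀ b ∈ A, dist z b = infDist z A → b ∈ U := by
  have hinf : Continuous fun q : α × α => infDist q.1 A :=
    (continuous_infDist_pt A).comp continuous_fst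
  have hcomp : IsCompact (closedBall y (infDist y A + 2)) := isCompact_closedBall _ _
  have hcompact : ∀ᶠ z in 𝓝 y, ∀ b ∈ closedBall y (infDist y A + 2),
      b ∈ A → dist z b = infDist z A → b ∈ U := by
    refine hcomp.eventually_forall_of_forall_eventually fun b _ => ?_
    have hsnd : Tendsto Prod.snd (𝓝 (y, b)) (𝓝 b) := continuous_snd.tendsto (y, b)
    by_cases hbA : b ∈ A
    · by_cases hb : dist y b = infDist y A
      · rw [← huniq b hbA hb] at hU
        exact (hsnd.eventually hU).mono fun _ h _ _ => h
      · have hne : ∀ᶠ q : α × α in 𝓝 (y, b), dist q.1 q.2 ≠ infDist q.1 A :=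
          (isOpen_ne_fun continuous_dist hinf).mem_nhds hb
        exact hne.mono fun _ h _ h' => absurd h' h
    · exact (hsnd.eventually (hA.isOpen_compl.mem_nhds hbA)).mono fun _ h h' => absurd h' h
  filter_upwards [hcompact, ball_mem_nhds y one_pos] with z hz hzy b hbA hb
  refine hz b ?_ hbA hb
  rw [mem_ball] at hzy
  rw [mem_closedBall, dist_comm]
  linarith [dist_triangle y z b, dist_comm y z,
    infDist_le_infDist_add_dist (s := A) (x := z) (y := y)]

end ProperMetricSpace

section PositiveReach

/-- Every point at distance less than `r` from `A` has a unique closest point in `A`. -/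
def UniqueProjWithin {α : Type*} [PseudoMetricSpace α] (A : Set α) (r : ℝ) : Prop :=
  ∀ y, infDist y A < r → ∃! a, a ∈ A ∧ dist y a = infDist y A

theorem exists_uniqueProjWithin_of_reach_pos {E : Type*} [NormedAddCommGroup E] {A : Set E}
    (hA : A.Nonempty) (h : 0 < reach A) : ∃ r > 0, UniqueProjWithin A r := by
  obtain ⟨t, ht, ht0⟩ := lt_sSup_iff.1 h
  obtain ⟨r, hr0, hrt⟩ := ENNReal.lt_iff_exists_nnreal_btwn.1 ht0
  refine ⟨r, by exact_mod_cast hr0, fun y hy => ht y (lt_trans ?_ hrt)⟩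
  rw [infDist] at hy
  rw [← ENNReal.ofReal_toReal (infEDist_ne_top hA), ← ENNReal.ofReal_coe_nnreal]
  exact (ENNReal.ofReal_lt_ofReal_iff_of_nonneg ENNReal.toReal_nonneg).2 hy

end PositiveReach

section ClosedComplement

variable {E : Type*} [NormedAddCommGroup E] {X : Set E} {x : E}

theorem compl_closedCompl : (closedCompl X)ᶜ = interior X := by
  rw [closedCompl, closure_compl, compl_compl]

theorem compl_closure_subset_closedCompl : (closure X)ᶜ ⊆ closedCompl X :=
  (Set.compl_subset_compl.2 subset_closure).trans subset_closure

theorem mem_closure_interior_of_mem_frontier_closedCompl (hx : x ∈ frontier (closedCompl X)) :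
    x ∈ closure (interior X) := by
  rw [← compl_closedCompl]
  exact (frontier_eq_closure_inter_closure.subset hx).2

theorem interior_closedCompl (hX : X ⊆ closure (interior X)) :
    interior (closedCompl X) = (closure X)ᶜ := by
  rw [interior_eq_compl_closure_compl, compl_closedCompl,
    (closure_mono interior_subset).antisymm (closure_minimal hX isClosed_closure)]

end ClosedComplement

variable {E : Type*} [NormedAddCommGroup E] [InnerProductSpace ℝ E]

section Differentiability

theorem norm_sub_norm_le_inner_normalize (v w : E) :
    ‖v‖ - ‖w‖ ≤ inner ℝ (NormedSpace.normalize v) (v - w) := by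
  rcases eq_or_ne v 0 with rfl | hv
  · simp
  · have hle := real_inner_le_norm (NormedSpace.normalize v) w
    rw [NormedSpace.norm_normalize_eq_one_iff.2 hv, one_mul] at hle
    have hself : inner ℝ (NormedSpace.normalize v) v = ‖v‖ := by
      rw [NormedSpace.normalize, real_inner_smul_left, real_inner_self_eq_norm_mul_norm,
        inv_mul_cancel_left₀ (norm_ne_zero_iff.2 hv)]
    rw [inner_sub_right, hself]
    linarith

theorem continuousAt_normalize {v : E} (hv : v ≠ 0) :
    ContinuousAt (NormedSpace.normalize : E → E) v :=
  (continuousAt_id.norm.inv₀ (norm_ne_zero_iff.2 hv)).smul continuousAt_id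

/- The increment of the distance is squeezed between two increments of the norm, one measured from
`p` and one from a closest point of `y'`; both have slope close to `normalize (y - p)`. -/
theorem hasGradientAt_infDist_of_unique [ProperSpace E] {S : Set E} (hS : IsClosed S) {y p : E}
    (hp : p ∈ S) (hyp : dist y p = infDist y S) (hne : y ≠ p)
    (huniq : ∀ b ∈ S, dist y b = infDist y S → b = p) :
    HasGradientAt (fun z => infDist z S) (NormedSpace.normalize (y - p)) y := by
  set u := NormedSpace.normalize (y - p) with hu
  rw [hasGradientAt_iff_isLittleO, Asymptotics.isLittleO_iff]
  intro c hc
  have hdir : Tendsto (fun q : E × E => NormedSpace.normalize (q.1 - q.2)) (𝓝 (y, p)) (𝓝 u) :=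
    (continuousAt_normalize (sub_ne_zero.2 hne)).comp_of_eq
      (f := fun q : E × E => q.1 - q.2) (by fun_prop) rfl
  rw [nhds_prod_eq] at hdir
  obtain ⟨P, hP, Q, hQ, hPQ⟩ :=
    eventually_prod_iff.1 (hdir.eventually (closedBall_mem_nhds u hc))
  have bound : ∀ {v : E}, v ∈ closedBall u c → ∀ h, |inner ℝ (v - u) h| ≤ c * ‖h‖ := fun hv h =>
    (abs_real_inner_le_norm _ _).trans (by gcongr; rwa [← dist_eq_norm])
  filter_upwards [hP, eventually_closest_mem_of_unique hS huniq hQ] with y' hy' hclose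
  obtain ⟨b, hb, hy'b⟩ := hS.exists_infDist_eq_dist ⟨p, hp⟩ y'
  have hupper := norm_sub_norm_le_inner_normalize (y' - p) (y - p)
  have hlower := norm_sub_norm_le_inner_normalize (y - b) (y' - b)
  have hupper' := bound (hPQ hy' hQ.self_of_nhds) (y' - y)
  have hlower' := bound (hPQ hP.self_of_nhds (hclose b hb hy'b.symm)) (y' - y)
  have hy'p : infDist y' S ≤ ‖y' - p‖ := dist_eq_norm y' p ▸ infDist_le_dist_of_mem hp
  have hyb : infDist y S ≤ ‖y - b‖ := dist_eq_norm y b ▸ infDist_le_dist_of_mem hb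
  rw [dist_eq_norm] at hyp hy'b
  rw [sub_sub_sub_cancel_right] at hupper hlower
  rw [← neg_sub y' y, inner_neg_right] at hlower
  rw [inner_sub_left, abs_le] at hupper' hlower'
  rw [Real.norm_eq_abs, abs_le]
  constructor <;> linarith

theorem frequently_add_mul_dist_lt_of_hasGradientAt [CompleteSpace E] {f : E → ℝ} {y u : E}
    (hf : HasGradientAt f u y) (hu : ‖u‖ = 1) {c : ℝ} (hc : c < 1) :
    ∃ᶠ y' in 𝓝 y, f y + c * dist y' y < f y' := by
  have hline : Tendsto (fun h : ℝ => y + h • u) (𝓝[>] 0) (𝓝 y) :=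
    tendsto_nhdsWithin_of_tendsto_nhds (Continuous.tendsto' (by fun_prop) _ _ (by simp))
  have hderiv : HasDerivAt (fun h : ℝ => f (y + h • u)) 1 0 := by
    simpa [HasLineDerivAt, hu] using hf.hasFDerivAt.hasLineDerivAt u
  refine hline.frequently (Eventually.frequently ?_)
  have hslope := hderiv.tendsto_slope.mono_left (nhdsGT_le_nhdsNE 0)
  filter_upwards [hslope.eventually (lt_mem_nhds hc), self_mem_nhdsWithin] with h hlt hpos
  have hpos : 0 < h := hpos
  rw [slope_def_field, sub_zero, lt_div_iff₀ hpos, zero_smul, add_zero] at hlt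
  rw [dist_self_add_left, norm_smul, hu, mul_one, Real.norm_of_nonneg hpos.le]
  linarith

theorem norm_gradient_le_one_of_lipschitzWith [CompleteSpace E] {f : E → ℝ}
    (hf : LipschitzWith 1 f) (y : E) : ‖gradient f y‖ ≤ 1 := by
  simpa [gradient] using norm_fderiv_le_of_lipschitz ℝ hf (x₀ := y)

end Differentiability

section ProximalNormal

theorem eq_smul_of_add_le_norm_add_smul {u h : E} {L t : ℝ} (hu : ‖u‖ = 1) (ht : 0 < t)
    (hh : ‖h‖ ≤ L) (hle : L + t ≤ ‖h + t • u‖) : h = L • u := by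
  have hL : 0 ≤ L := (norm_nonneg h).trans hh
  have hsq : (L + t) ^ 2 ≤ ‖h‖ ^ 2 + 2 * t * inner ℝ h u + t ^ 2 := by
    have := pow_le_pow_left₀ (by positivity) hle 2
    rw [norm_add_sq_real, inner_smul_right, norm_smul, hu, mul_one, Real.norm_of_nonneg ht.le]
      at this
    linarith
  have hhL : ‖h‖ ^ 2 ≤ L ^ 2 := pow_le_pow_left₀ (norm_nonneg h) hh 2
  have hinner : L ≤ inner ℝ h u := by nlinarith
  have hdist : ‖h - L • u‖ ^ 2 ≤ 0 := by
    rw [norm_sub_sq_real, inner_smul_right, norm_smul, hu, mul_one, Real.norm_of_nonneg hL]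
    nlinarith [mul_le_mul_of_nonneg_left hinner hL]
  exact norm_sub_eq_zero_iff.1 ((sq_nonpos_iff _).1 hdist)

/-- `u` is a unit proximal normal of `S` at `p`, realised by a ball of radius `t`: the open ball of
radius `t` centred at `p + t • u` misses `S` and has `p ∈ S` on its boundary. -/
structure IsUnitProximalNormal (S : Set E) (t : ℝ) (p u : E) : Prop where
  mem : p ∈ S
  norm_eq : ‖u‖ = 1
  infDist_eq : infDist (p + t • u) S = t

namespace IsUnitProximalNormal

variable {S : Set E} {s t : ℝ} {p u b : E}

theorem radius_nonneg (h : IsUnitProximalNormal S t p u) : 0 ≤ t :=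
  h.infDist_eq ▸ infDist_nonneg

theorem le_dist (h : IsUnitProximalNormal S t p u) (hb : b ∈ S) : t ≤ dist (p + t • u) b :=
  h.infDist_eq.ge.trans (infDist_le_dist_of_mem hb)

theorem of_le_infDist (hp : p ∈ S) (hu : ‖u‖ = 1) (ht : 0 ≤ t) (h : t ≤ infDist (p + t • u) S) :
    IsUnitProximalNormal S t p u where
  mem := hp
  norm_eq := hu
  infDist_eq := by
    refine le_antisymm ?_ h
    simpa [norm_smul, hu, abs_of_nonneg ht] using infDist_le_dist_of_mem (x := p + t • u) hp

theorem of_le (h : IsUnitProximalNormal S t p u) (hs : 0 ≤ s) (hst : s ≤ t) :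
    IsUnitProximalNormal S s p u := by
  refine of_le_infDist h.mem h.norm_eq hs ?_
  have hdist : dist (p + t • u) (p + s • u) = t - s := by
    rw [dist_add_left, dist_eq_norm, ← sub_smul, norm_smul, h.norm_eq, mul_one,
      Real.norm_of_nonneg (sub_nonneg.2 hst)]
  linarith [infDist_le_infDist_add_dist (s := S) (x := p + t • u) (y := p + s • u), h.infDist_eq]

theorem eq_of_dist_eq (h : IsUnitProximalNormal S t p u) (hst : s < t) (hb : b ∈ S)
    (hdist : dist (p + s • u) b = s) : b = p := by
  have hs : ‖p + s • u - b‖ ≤ s := by rw [← dist_eq_norm, hdist]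
  have hle : s + (t - s) ≤ ‖p + s • u - b + (t - s) • u‖ := by
    convert h.le_dist hb using 1
    · ring
    · rw [dist_eq_norm]
      congr 1
      module
  have := eq_smul_of_add_le_norm_add_smul h.norm_eq (sub_pos.2 hst) hs hle
  rw [add_sub_right_comm, add_eq_right, sub_eq_zero] at this
  exact this.symm

theorem hasGradientAt_infDist [ProperSpace E] (hS : IsClosed S) (h : IsUnitProximalNormal S t p u)
    (hs : 0 < s) (hst : s < t) : HasGradientAt (fun z => infDist z S) u (p + s • u) := by
  have hinf : infDist (p + s • u) S = s := (h.of_le hs.le hst.le).infDist_eq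
  have hu : u ≠ 0 := norm_ne_zero_iff.1 (by simp [h.norm_eq])
  have hgrad := hasGradientAt_infDist_of_unique hS h.mem
    (y := p + s • u) (by simp [hinf, norm_smul, h.norm_eq, abs_of_pos hs])
    (by simp [hs.ne', hu]) (fun b hb hdist => h.eq_of_dist_eq hst hb (hdist.trans hinf))
  rwa [add_sub_cancel_left, NormedSpace.normalize_smul_of_pos hs,
    NormedSpace.normalize_eq_self_of_norm_eq_one h.norm_eq] at hgrad

theorem gradient_eq [CompleteSpace E] (h : IsUnitProximalNormal S t p u) (ht : 0 < t)
    (hd : DifferentiableAt ℝ (fun z => infDist z S) (p + t • u)) :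
    gradient (fun z => infDist z S) (p + t • u) = u := by
  set g := gradient (fun z => infDist z S) (p + t • u)
  have hline : HasDerivAt (fun τ : ℝ => p + τ • u) u t := by
    simpa using ((hasDerivAt_id t).smul_const u).const_add p
  have hderiv : HasDerivAt (fun τ : ℝ => infDist (p + τ • u) S) (inner ℝ g u) t :=
    HasFDerivAt.comp_hasDerivAt (f := fun τ : ℝ => p + τ • u) t
      hd.hasGradientAt.hasFDerivAt hline
  have hid : HasDerivWithinAt (fun τ : ℝ => infDist (p + τ • u) S) 1 (Set.Icc 0 t) t :=
    (hasDerivWithinAt_id t _).congr_of_mem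
      (fun τ hτ => (h.of_le hτ.1 hτ.2).infDist_eq) (Set.right_mem_Icc.2 ht.le)
  have hone : inner ℝ g u = 1 :=
    (uniqueDiffOn_Icc ht t (Set.right_mem_Icc.2 ht.le)).eq_deriv _ hderiv.hasDerivWithinAt hid
  have hnorm : ‖g‖ = 1 := by
    refine le_antisymm (norm_gradient_le_one_of_lipschitzWith (lipschitz_infDist_pt S) _) ?_
    simpa [hone, h.norm_eq] using real_inner_le_norm g u
  exact (inner_eq_one_iff_of_norm_eq_one hnorm h.norm_eq).1 hone

theorem two_mul_inner_le_norm_sq (h : IsUnitProximalNormal S t p u) (hb : b ∈ S) :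
    2 * t * inner ℝ u (b - p) ≤ ‖b - p‖ ^ 2 := by
  have hsq := pow_le_pow_left₀ h.radius_nonneg (h.le_dist hb) 2
  rw [dist_eq_norm, add_sub_right_comm, ← neg_sub b p, neg_add_eq_sub, norm_sub_sq_real,
    norm_smul, h.norm_eq, real_inner_smul_left, mul_one, Real.norm_of_nonneg h.radius_nonneg]
    at hsq
  linarith

theorem mem_normalCone (h : IsUnitProximalNormal S t p u) (ht : 0 < t) : u ∈ normalCone S p := by
  rintro _ ⟨c, hc, v, ⟨y, hy, hyp, hyv⟩, rfl⟩
  rw [inner_smul_right]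
  refine mul_nonpos_of_nonneg_of_nonpos hc (le_of_mul_le_mul_left ?_ (by positivity : 0 < 2 * t))
  have hlim : Tendsto (fun n => ‖y n - p‖) atTop (𝓝 (2 * t * 0)) := by
    simpa using (hyp.sub_const p).norm
  refine le_of_tendsto_of_tendsto' ((tendsto_const_nhds.inner hyv).const_mul (2 * t)) hlim
    fun n => ?_
  have hpos : 0 < ‖y n - p‖ := norm_sub_pos_iff.2 (hy n).2
  calc 2 * t * inner ℝ u (‖y n - p‖⁻¹ • (y n - p))
      = ‖y n - p‖⁻¹ * (2 * t * inner ℝ u (y n - p)) := by rw [inner_smul_right]; ring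
    _ ≤ ‖y n - p‖⁻¹ * ‖y n - p‖ ^ 2 := by gcongr; exact h.two_mul_inner_le_norm_sq (hy n).1
    _ = ‖y n - p‖ := by field_simp

end IsUnitProximalNormal

theorem isClosed_setOf_isUnitProximalNormal {S : Set E} (hS : IsClosed S) (t : ℝ) :
    IsClosed {q : E × E | IsUnitProximalNormal S t q.1 q.2} := by
  have hset : {q : E × E | IsUnitProximalNormal S t q.1 q.2} =
      {q | q.1 ∈ S} ∩ ({q | ‖q.2‖ = 1} ∩ {q | infDist (q.1 + t • q.2) S = t}) :=
    Set.ext fun q => ⟨fun h => ⟨h.1, h.2, h.3⟩, fun h => ⟨h.1, h.2.1, h.2.2⟩⟩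
  rw [hset]
  exact (hS.preimage continuous_fst).inter ((isClosed_eq (by fun_prop) continuous_const).inter
    (isClosed_eq ((continuous_infDist_pt S).comp (by fun_prop)) continuous_const))

theorem exists_isUnitProximalNormal_add_smul_eq [ProperSpace E] {S : Set E} (hS : IsClosed S)
    (hne : S.Nonempty) {z : E} (hz : z ∉ S) :
    ∃ p u, IsUnitProximalNormal S (infDist z S) p u ∧ p + infDist z S • u = z := by
  obtain ⟨p, hp, hzp⟩ := hS.exists_infDist_eq_dist hne z
  have hzp0 : z - p ≠ 0 := sub_ne_zero.2 fun h => hz (h ▸ hp)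
  have hsmul : p + infDist z S • NormedSpace.normalize (z - p) = z := by
    rw [hzp, dist_eq_norm, NormedSpace.norm_smul_normalize, add_sub_cancel]
  exact ⟨p, _, ⟨hp, NormedSpace.norm_normalize_eq_one_iff.2 hzp0, by rw [hsmul]⟩, hsmul⟩

end ProximalNormal

section LimitingNormal

/-- The pairs `(p, u)` such that `u` is a unit proximal normal of `S` at `p`. -/
def proximalNormalGraph (S : Set E) : Set (E × E) :=
  {q | ∃ t > 0, IsUnitProximalNormal S t q.1 q.2}

/-- The limits of unit proximal normals of `S` at points converging to `x`. -/
def unitLimitingNormals (S : Set E) (x : E) : Set E :=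
  {v | (x, v) ∈ closure (proximalNormalGraph S)}

variable {S : Set E} {x y : E}

theorem norm_eq_one_of_mem_unitLimitingNormals {v : E} (hv : v ∈ unitLimitingNormals S x) :
    ‖v‖ = 1 :=
  closure_minimal (t := {q : E × E | ‖q.2‖ = 1}) (fun _ h => h.choose_spec.2.norm_eq)
    (isClosed_eq (by fun_prop) continuous_const) hv

theorem ne_zero_of_mem_unitLimitingNormals {v : E} (hv : v ∈ unitLimitingNormals S x) : v ≠ 0 :=
  norm_ne_zero_iff.1 (by simp [norm_eq_one_of_mem_unitLimitingNormals hv])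

theorem isCompact_unitLimitingNormals [ProperSpace E] : IsCompact (unitLimitingNormals S x) :=
  (isCompact_sphere (0 : E) 1).of_isClosed_subset
    (isClosed_closure.preimage (by fun_prop : Continuous fun v : E => (x, v)))
    fun _ hv => by simpa using norm_eq_one_of_mem_unitLimitingNormals hv

theorem hasGradientAt_infDist_of_mem_interior [CompleteSpace E] (hy : y ∈ interior S) :
    HasGradientAt (fun z => infDist z S) 0 y := by
  refine (hasGradientAt_const y (0 : ℝ)).congr_of_eventuallyEq ?_
  filter_upwards [isOpen_interior.mem_nhds hy] with z hz
  exact infDist_zero_of_mem (interior_subset hz)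

theorem gradient_infDist_eq_zero_of_mem [CompleteSpace E] (hy : y ∈ S) :
    gradient (fun z => infDist z S) y = 0 := by
  have hmin : IsLocalMin (fun z => infDist z S) y := Eventually.of_forall fun z =>
    (infDist_zero_of_mem hy).le.trans infDist_nonneg
  rw [gradient, hmin.fderiv_eq_zero, map_zero]

theorem gradient_infDist_eq_zero_or_exists_mem_proximalNormalGraph [ProperSpace E]
    (hS : IsClosed S) (hx : x ∈ S) (hd : DifferentiableAt ℝ (fun z => infDist z S) y) :
    gradient (fun z => infDist z S) y = 0 ∨
      ∃ p, (p, gradient (fun z => infDist z S) y) ∈ proximalNormalGraph S ∧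
        dist p x ≤ 2 * dist y x := by
  by_cases hy : y ∈ S
  · exact .inl (gradient_infDist_eq_zero_of_mem hy)
  · have hpos : 0 < infDist y S := (hS.notMem_iff_infDist_pos ⟨x, hx⟩).1 hy
    obtain ⟨p, u, h, hpu⟩ := exists_isUnitProximalNormal_add_smul_eq hS ⟨x, hx⟩ hy
    refine .inr ⟨p, ⟨_, hpos, ?_⟩, ?_⟩
    · rw [← hpu] at hd
      have hgrad := h.gradient_eq hpos hd
      rw [hpu] at hgrad
      rwa [hgrad]
    · have hpy : dist p y = infDist y S := by
        conv_lhs => rw [← hpu]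
        rw [dist_self_add_right, norm_smul, h.norm_eq, mul_one, Real.norm_of_nonneg hpos.le]
      linarith [dist_triangle p y x, infDist_le_dist_of_mem (x := y) hx]

theorem mem_unitLimitingNormals_of_tendsto_gradient [ProperSpace E] (hS : IsClosed S) (hx : x ∈ S)
    {z : ℕ → E} {v : E} (hd : ∀ n, DifferentiableAt ℝ (fun y => infDist y S) (z n))
    (hz : Tendsto z atTop (𝓝 x))
    (hv : Tendsto (fun n => gradient (fun y => infDist y S) (z n)) atTop (𝓝 v)) (hv0 : v ≠ 0) :
    v ∈ unitLimitingNormals S x := by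
  refine Metric.mem_closure_iff.2 fun ε hε => ?_
  obtain ⟨n, hzn, hvn, hne⟩ := ((hz.eventually (ball_mem_nhds x (half_pos hε))).and
    ((hv.eventually (ball_mem_nhds v hε)).and (hv.eventually_ne hv0))).exists
  obtain h0 | ⟨p, hp, hpx⟩ :=
    gradient_infDist_eq_zero_or_exists_mem_proximalNormalGraph hS hx (hd n)
  · exact absurd h0 hne
  · have hpx' : dist p x < ε := by linarith [show dist (z n) x < ε / 2 from hzn]
    exact ⟨_, hp, max_lt (dist_comm p x ▸ hpx') (mem_ball'.1 hvn)⟩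

theorem exists_seq_tendsto_gradient_of_mem_unitLimitingNormals [ProperSpace E] (hS : IsClosed S)
    {v : E} (hv : v ∈ unitLimitingNormals S x) :
    ∃ z : ℕ → E, (∀ n, DifferentiableAt ℝ (fun y => infDist y S) (z n)) ∧
      Tendsto z atTop (𝓝 x) ∧
      Tendsto (fun n => gradient (fun y => infDist y S) (z n)) atTop (𝓝 v) := by
  obtain ⟨q, hq, hlim⟩ := mem_closure_iff_seq_limit.1 hv
  choose t ht hprox using hq
  choose s hs hst using fun n : ℕ =>
    exists_between (lt_min (ht n) (Nat.one_div_pos_of_nat (n := n)))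
  have hgrad n : HasGradientAt (fun y => infDist y S) (q n).2 ((q n).1 + s n • (q n).2) :=
    (hprox n).hasGradientAt_infDist hS (hs n) ((hst n).trans_le (min_le_left _ _))
  have hs0 : Tendsto s atTop (𝓝 0) :=
    squeeze_zero (fun n => (hs n).le) (fun n => ((hst n).trans_le (min_le_right _ _)).le)
      tendsto_one_div_add_atTop_nhds_zero_nat
  refine ⟨_, fun n => (hgrad n).differentiableAt, ?_, ?_⟩
  · simpa using hlim.fst_nhds.add (hs0.smul hlim.snd_nhds)
  · simpa only [(hgrad _).gradient] using hlim.snd_nhds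

theorem clarkeGradient_infDist_eq [ProperSpace E] (hS : IsClosed S)
    (hx : x ∈ closure (interior S)) :
    clarkeGradient (fun y => infDist y S) x =
      convexHull ℝ (insert 0 (unitLimitingNormals S x)) := by
  refine congrArg (convexHull ℝ) (Set.Subset.antisymm ?_ (Set.insert_subset ?_ fun v hv =>
    exists_seq_tendsto_gradient_of_mem_unitLimitingNormals hS hv))
  · rintro v ⟨z, hd, hz, hv⟩
    have hxS : x ∈ S := closure_minimal interior_subset hS hx
    exact or_iff_not_imp_left.2 (mem_unitLimitingNormals_of_tendsto_gradient hS hxS hd hz hv)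
  · obtain ⟨z, hzS, hz⟩ := mem_closure_iff_seq_limit.1 hx
    have hgrad n := hasGradientAt_infDist_of_mem_interior (hzS n)
    refine ⟨z, fun n => (hgrad n).differentiableAt, hz, ?_⟩
    simp only [(hgrad _).gradient, tendsto_const_nhds]

end LimitingNormal

section Hypertangent

/-- `w` is a hypertangent direction of `S` at `x` in the sense of Rockafellar: every direction close
to `w`, followed for a short time from a point of `S` close to `x`, leads back into `S`. -/
def IsHypertangent (S : Set E) (x w : E) : Prop :=
  ∀ᶠ q : ℝ × E × E in 𝓝[>] 0 ×ˢ 𝓝 (x, w), q.2.1 ∈ S → q.2.1 + q.1 • q.2.2 ∈ S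

variable {S : Set E} {x w : E}

theorem IsHypertangent.eventually_mem_interior (h : IsHypertangent S x w) (hx : x ∈ S) :
    ∀ᶠ t in 𝓝[>] (0 : ℝ), x + t • w ∈ interior S := by
  filter_upwards [h.curry, self_mem_nhdsWithin] with t ht hpos
  have hpos : t ≠ 0 := ne_of_gt hpos
  have hlim : Tendsto (fun z => (x, t⁻¹ • (z - x))) (𝓝 (x + t • w)) (𝓝 (x, w)) :=
    Continuous.tendsto' (by fun_prop) _ _ (by simp [smul_smul, hpos])
  refine mem_interior_iff_mem_nhds.2 (mem_of_superset (hlim.eventually ht) fun z hz => ?_)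
  simpa [smul_smul, hpos] using hz hx

theorem IsHypertangent.mem_closure_interior (h : IsHypertangent S x w) (hx : x ∈ S) :
    x ∈ closure (interior S) :=
  mem_closure_of_tendsto (f := fun t : ℝ => x + t • w) (b := 𝓝[>] 0)
    (tendsto_nhdsWithin_of_tendsto_nhds (Continuous.tendsto' (by fun_prop) _ _ (by simp)))
    (h.eventually_mem_interior hx)

theorem IsHypertangent.compl_neg (h : IsHypertangent S x w) : IsHypertangent Sᶜ x (-w) := by
  have hfst : Tendsto Prod.fst (𝓝[>] (0 : ℝ) ×ˢ 𝓝 (x, -w)) (𝓝[>] 0) := tendsto_fst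
  have hback : Tendsto (fun q : ℝ × E × E => (q.2.1 + q.1 • q.2.2, -q.2.2))
      (𝓝[>] 0 ×ˢ 𝓝 (x, -w)) (𝓝 (x, w)) := by
    have hcont : Tendsto (fun q : ℝ × E × E => (q.2.1 + q.1 • q.2.2, -q.2.2))
        (𝓝 (0, x, -w)) (𝓝 (x, w)) := Continuous.tendsto' (by fun_prop) _ _ (by simp)
    rw [nhds_prod_eq] at hcont
    exact hcont.mono_left (prod_mono_left _ nhdsWithin_le_nhds)
  filter_upwards [(hfst.prodMk hback).eventually h] with q hq hqS hmem
  exact hqS (by simpa using hq hmem)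

theorem IsHypertangent.eventually_mem_closure (h : IsHypertangent S x w) (hx : x ∈ closure S) :
    ∀ᶠ t in 𝓝[>] (0 : ℝ), x + t • w ∈ closure S := by
  filter_upwards [h.curry] with t ht
  have hpair : Tendsto (fun y => (y, w)) (𝓝 x) (𝓝 (x, w)) := Continuous.tendsto (by fun_prop) x
  have hshift : Tendsto (fun y => y + t • w) (𝓝 x) (𝓝 (x + t • w)) :=
    Continuous.tendsto (by fun_prop) x
  refine mem_closure_iff_frequently.2 (hshift.frequently ?_)
  exact (mem_closure_iff_frequently.1 hx).mp ((hpair.eventually ht).mono fun _ => id)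

theorem IsUnitProximalNormal.eventually_infDist_add_smul_le {t : ℝ} {p u : E}
    (h : IsUnitProximalNormal S t p u) (ht : 0 < t) (hw : inner ℝ u w < 0) :
    ∀ᶠ η in 𝓝[>] (0 : ℝ), infDist (p + t • u + η • w) S ≤ t := by
  have hsmall : ∀ᶠ η in 𝓝[>] (0 : ℝ), 2 * t * inner ℝ u w + η * ‖w‖ ^ 2 < 0 := by
    have hlim : Tendsto (fun η : ℝ => 2 * t * inner ℝ u w + η * ‖w‖ ^ 2) (𝓝[>] 0)
        (𝓝 (2 * t * inner ℝ u w)) :=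
      tendsto_nhdsWithin_of_tendsto_nhds (Continuous.tendsto' (by fun_prop) _ _ (by simp))
    exact hlim.eventually_lt_const (mul_neg_of_pos_of_neg (by positivity) hw)
  filter_upwards [hsmall, self_mem_nhdsWithin] with η hη hpos
  have hpos : 0 < η := hpos
  refine (infDist_le_dist_of_mem h.mem).trans (le_of_sq_le_sq ?_ ht.le)
  calc dist (p + t • u + η • w) p ^ 2
      = ‖t • u + η • w‖ ^ 2 := by rw [add_assoc, dist_self_add_left]
    _ = t ^ 2 + η * (2 * t * inner ℝ u w + η * ‖w‖ ^ 2) := by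
      rw [norm_add_sq_real, real_inner_smul_left, real_inner_smul_right, norm_smul, norm_smul,
        h.norm_eq, Real.norm_of_nonneg ht.le, Real.norm_of_nonneg hpos.le]
      ring
    _ ≤ t ^ 2 := by nlinarith

/- A point at distance exactly `ε` from `S` has a closest point `p` at which the proximal normal
makes an obtuse angle with `w`, so moving on along `w` does not take the distance above `ε`. -/
theorem infDist_add_smul_le_of_forall_inner_neg [ProperSpace E] (hS : IsClosed S) {y : E}
    (hy : y ∈ S) {T ε : ℝ} (hT : 0 ≤ T) (hε : 0 < ε)
    (hneg : ∀ p u, dist p y ≤ 2 * T * ‖w‖ → (p, u) ∈ proximalNormalGraph S → inner ℝ u w < 0) :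
    infDist (y + T • w) S ≤ ε := by
  have hcont : Continuous fun τ : ℝ => infDist (y + τ • w) S :=
    (continuous_infDist_pt S).comp (by fun_prop)
  suffices Set.Icc 0 T ⊆ {τ | infDist (y + τ • w) S ≤ ε} from this (Set.right_mem_Icc.2 hT)
  refine IsClosed.Icc_subset_of_forall_mem_nhdsWithin
    ((isClosed_le hcont continuous_const).inter isClosed_Icc)
    (by simp [infDist_zero_of_mem hy, hε.le]) ?_
  rintro τ ⟨hτ, hτ0, hτT⟩
  rcases (show infDist (y + τ • w) S ≤ ε from hτ).lt_or_eq with hlt | heq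
  · filter_upwards [mem_nhdsWithin_of_mem_nhds ((isOpen_Iio.preimage hcont).mem_nhds hlt)] with σ hσ
    exact le_of_lt hσ
  · have hnot : y + τ • w ∉ S := (hS.notMem_iff_infDist_pos ⟨y, hy⟩).2 (heq ▸ hε)
    obtain ⟨p, u, h, hpu⟩ := exists_isUnitProximalNormal_add_smul_eq hS ⟨y, hy⟩ hnot
    rw [heq] at h hpu
    have hpy : dist p y ≤ 2 * T * ‖w‖ := by
      have hdist : dist (y + τ • w) y = τ * ‖w‖ := by
        rw [dist_self_add_left, norm_smul, Real.norm_of_nonneg hτ0]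
      have hle : τ * ‖w‖ ≤ T * ‖w‖ := by gcongr
      have hpε : dist p (y + τ • w) = ε := by
        rw [← hpu, dist_self_add_right, norm_smul, h.norm_eq, mul_one, Real.norm_of_nonneg hε.le]
      linarith [dist_triangle p (y + τ • w) y, infDist_le_dist_of_mem (x := y + τ • w) hy]
    have hdesc := h.eventually_infDist_add_smul_le hε (hneg p u hpy ⟨ε, hε, h⟩)
    rw [hpu] at hdesc
    rw [← add_zero τ, ← map_add_left_nhdsGT, mem_map]
    filter_upwards [hdesc] with η hη
    simpa [add_smul, add_assoc] using hη

theorem eventually_forall_inner_neg [ProperSpace E]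
    (hw : ∀ v ∈ unitLimitingNormals S x, inner ℝ v w < 0) :
    ∀ᶠ q in 𝓝 (x, w), ∀ u, (q.1, u) ∈ proximalNormalGraph S → inner ℝ u q.2 < 0 := by
  have hsphere : ∀ᶠ q in 𝓝 (x, w), ∀ u ∈ sphere (0 : E) 1,
      (q.1, u) ∈ proximalNormalGraph S → inner ℝ u q.2 < 0 := by
    refine (isCompact_sphere 0 1).eventually_forall_of_forall_eventually fun u _ => ?_
    by_cases hu : u ∈ unitLimitingNormals S x
    · have hneg : ∀ᶠ z : (E × E) × E in 𝓝 ((x, w), u), inner ℝ z.2 z.1.2 < 0 :=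
        (isOpen_lt (by fun_prop) continuous_const).mem_nhds (hw u hu)
      exact hneg.mono fun _ h _ => h
    · have hnot : ∀ᶠ z : (E × E) × E in 𝓝 ((x, w), u),
          (z.1.1, z.2) ∉ closure (proximalNormalGraph S) :=
        (isClosed_closure.isOpen_compl.preimage (by fun_prop)).mem_nhds hu
      exact hnot.mono fun _ h h' => absurd (subset_closure h') h
  filter_upwards [hsphere] with q hq u hu
  obtain ⟨t, -, h⟩ := id hu
  exact hq u (by simpa using h.norm_eq) hu

theorem isHypertangent_of_forall_inner_neg [ProperSpace E] (hS : IsClosed S)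
    (hw : ∀ v ∈ unitLimitingNormals S x, inner ℝ v w < 0) : IsHypertangent S x w := by
  obtain ⟨δ, hδ, hneg⟩ := Metric.eventually_nhds_iff_ball.1 (eventually_forall_inner_neg hw)
  have hsnd : Tendsto Prod.snd (𝓝[>] (0 : ℝ) ×ˢ 𝓝 (x, w)) (𝓝 (x, w)) := tendsto_snd
  have hshort : Tendsto (fun q : ℝ × E × E => 2 * q.1 * ‖q.2.2‖) (𝓝[>] 0 ×ˢ 𝓝 (x, w)) (𝓝 0) := by
    have hcont : Tendsto (fun q : ℝ × E × E => 2 * q.1 * ‖q.2.2‖) (𝓝 (0, x, w)) (𝓝 0) :=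
      Continuous.tendsto' (by fun_prop) _ _ (by simp)
    rw [nhds_prod_eq] at hcont
    exact hcont.mono_left (prod_mono_left _ nhdsWithin_le_nhds)
  filter_upwards [hsnd.eventually (ball_mem_nhds _ (half_pos hδ)),
    hshort.eventually_lt_const (half_pos hδ), tendsto_fst.eventually self_mem_nhdsWithin]
    with ⟨T, y, w'⟩ hnear (hlt : 2 * T * ‖w'‖ < δ / 2) (hT : 0 < T) (hy : y ∈ S)
  obtain ⟨hyx, hww⟩ : dist y x < δ / 2 ∧ dist w' w < δ / 2 := max_lt_iff.1 hnear
  refine (hS.mem_iff_infDist_zero ⟨y, hy⟩).2 (le_antisymm (le_of_forall_pos_le_add fun ε hε => ?_)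
    infDist_nonneg)
  rw [zero_add]
  refine infDist_add_smul_le_of_forall_inner_neg hS hy hT.le hε
    fun p u (hpy : dist p y ≤ 2 * T * ‖w'‖) hpu =>
      hneg (p, w') (max_lt ?_ (hww.trans (half_lt_self hδ))) u hpu
  exact lt_of_le_of_lt (dist_triangle p y x) (by linarith)

theorem nonempty_unitLimitingNormals_of_mem_frontier [ProperSpace E] (hS : IsClosed S)
    (hx : x ∈ frontier S) : (unitLimitingNormals S x).Nonempty := by
  by_contra hempty
  rw [Set.not_nonempty_iff_eq_empty] at hempty
  have hzero : IsHypertangent S x 0 :=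
    isHypertangent_of_forall_inner_neg hS fun v hv => absurd (hempty ▸ hv) (Set.notMem_empty v)
  obtain ⟨t, ht⟩ := (hzero.eventually_mem_interior (hS.frontier_subset hx)).exists
  exact hx.2 (by simpa using ht)

end Hypertangent

section Prolongation

variable {A : Set E} {r : ℝ} {x : E}

/- Federer: `infDist · A` climbs with slope `1` as long as closest points are unique, so from
`a + t • u` it reaches the value `s` within distance `s - t`, and only `a + s • u` is possible. -/
theorem IsUnitProximalNormal.prolong [ProperSpace E] (hA : IsClosed A) (hr : UniqueProjWithin A r)
    {s t : ℝ} {a u : E} (h : IsUnitProximalNormal A t a u) (ht : 0 < t) (hts : t ≤ s)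
    (hsr : s < r) : IsUnitProximalNormal A s a u := by
  have hL : 0 ≤ s - t := sub_nonneg.2 hts
  obtain ⟨y, hy, hfar⟩ := exists_add_le_of_frequently_steep (continuous_infDist_pt A)
    (z := a + t • u) hL fun y hy hzy c hc => by
      have hpos : 0 < infDist y A := ht.trans_le (h.infDist_eq ▸ hzy)
      have hyr : infDist y A < r := by
        linarith [infDist_le_infDist_add_dist (s := A) (x := y) (y := a + t • u), h.infDist_eq]
      obtain ⟨p, ⟨hpA, hyp⟩, huniq⟩ := hr y hyr
      have hne : y ≠ p := dist_pos.1 (hyp ▸ hpos)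
      exact frequently_add_mul_dist_lt_of_hasGradientAt
        (hasGradientAt_infDist_of_unique hA hpA hyp hne fun b hb hyb => huniq b ⟨hb, hyb⟩)
        (NormedSpace.norm_normalize_eq_one_iff.2 (sub_ne_zero.2 hne)) hc
  rw [h.infDist_eq] at hfar
  have hya : s - t + t ≤ ‖y - (a + t • u) + t • u‖ := by
    rw [show y - (a + t • u) + t • u = y - a by abel, ← dist_eq_norm]
    linarith [infDist_le_dist_of_mem (x := y) h.mem]
  have hyu := eq_smul_of_add_le_norm_add_smul h.norm_eq ht (mem_closedBall_iff_norm.1 hy) hya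
  have hys : y = a + s • u := by
    rw [← sub_add_cancel y (a + t • u), hyu]
    module
  exact of_le_infDist h.mem h.norm_eq (ht.le.trans hts) (by rw [← hys]; linarith)

theorem UniqueProjWithin.isUnitProximalNormal_of_mem_unitLimitingNormals [ProperSpace E]
    (hr : UniqueProjWithin A r) (hA : IsClosed A) {s : ℝ} (hs : 0 < s) (hsr : s < r) {v : E}
    (hv : v ∈ unitLimitingNormals A x) : IsUnitProximalNormal A s x v := by
  refine closure_minimal ?_ (isClosed_setOf_isUnitProximalNormal hA s) hv
  rintro ⟨p, u⟩ ⟨t, ht, h⟩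
  rcases le_total t s with hts | hst
  · exact h.prolong hA hr ht hts hsr
  · exact h.of_le hs.le hst

theorem UniqueProjWithin.unitLimitingNormals_subset_normalCone [ProperSpace E]
    (hr : UniqueProjWithin A r) (hA : IsClosed A) (hr0 : 0 < r) :
    unitLimitingNormals A x ⊆ normalCone A x := fun _ hv =>
  (hr.isUnitProximalNormal_of_mem_unitLimitingNormals hA (half_pos hr0) (half_lt_self hr0)
    hv).mem_normalCone (half_pos hr0)

/- A proximal normal `m` of `A` at `p` is realised by a ball missing `A`; it is disjoint from the
ball inside `A`, and both have `p` on their boundary, so `m = -v`. -/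
theorem UniqueProjWithin.isUnitProximalNormal_neg_of_ball_subset [ProperSpace E]
    (hr : UniqueProjWithin A r) (hA : IsClosed A) {s t : ℝ} (hs : 0 < s) (hsr : s < r) {p v : E}
    (hp : p ∈ frontier A) (ht : 0 < t) (hv : ‖v‖ = 1) (hball : ball (p + t • v) t ⊆ A) :
    IsUnitProximalNormal A s p (-v) := by
  obtain ⟨m, hm⟩ := nonempty_unitLimitingNormals_of_mem_frontier hA hp
  have h : IsUnitProximalNormal A s p m :=
    hr.isUnitProximalNormal_of_mem_unitLimitingNormals hA hs hsr hm
  have hdisj : Disjoint (ball (p + t • v) t) (ball (p + s • m) s) := by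
    refine Set.disjoint_left.2 fun z hzv hzm => ?_
    have := h.le_dist (hball hzv)
    rw [dist_comm] at this
    exact this.not_gt hzm
  have hcentres : s + t ≤ ‖s • (-m) + t • v‖ := by
    have := (disjoint_ball_ball_iff ht hs).1 hdisj
    rw [dist_add_left, dist_eq_norm] at this
    rw [smul_neg, neg_add_eq_sub]
    linarith
  have hmv : s • (-m) = s • v := eq_smul_of_add_le_norm_add_smul hv ht
    (by rw [norm_smul, norm_neg, h.norm_eq, mul_one, Real.norm_of_nonneg hs.le]) hcentres
  rw [← smul_right_injective E hs.ne' hmv, neg_neg]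
  exact h

end Prolongation

section ProximalNormalsOfClosedComplement

variable {X : Set E} {x : E}

theorem mem_frontier_closedCompl_of_ball_subset (hX : X ⊆ closure (interior X)) {t : ℝ} {p c : E}
    (hp : p ∈ closure X) (ht : t ≠ 0) (hpc : dist p c ≤ t) (hball : ball c t ⊆ closedCompl X) :
    p ∈ frontier (closedCompl X) := by
  have hpA : p ∈ closedCompl X := by
    refine closure_minimal hball isClosed_closure ?_
    rwa [closure_ball c ht]
  refine ⟨subset_closure hpA, fun hint => ?_⟩
  rw [interior_closedCompl hX] at hint
  exact hint hp

theorem neg_mem_unitLimitingNormals_closedCompl [ProperSpace E] (hX : X ⊆ closure (interior X))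
    {r : ℝ} (hr0 : 0 < r) (hr : UniqueProjWithin (closedCompl X) r) {v : E}
    (hv : v ∈ unitLimitingNormals (closure X) x) :
    -v ∈ unitLimitingNormals (closedCompl X) x := by
  have hgraph : Set.MapsTo (fun q : E × E => (q.1, -q.2)) (proximalNormalGraph (closure X))
      (proximalNormalGraph (closedCompl X)) := by
    rintro ⟨p, u⟩ ⟨t, ht, h⟩
    have hball : ball (p + t • u) t ⊆ closedCompl X := fun z hz =>
      compl_closure_subset_closedCompl fun hzX =>
        (h.le_dist hzX).not_gt (by rwa [dist_comm])
    have hp : p ∈ frontier (closedCompl X) :=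
      mem_frontier_closedCompl_of_ball_subset hX h.mem ht.ne'
        (by simp [norm_smul, h.norm_eq, abs_of_pos ht]) hball
    exact ⟨r / 2, half_pos hr0,
      hr.isUnitProximalNormal_neg_of_ball_subset isClosed_closure (half_pos hr0) (half_lt_self hr0)
        hp ht h.norm_eq hball⟩
  exact map_mem_closure (f := fun q : E × E => (q.1, -q.2)) (by fun_prop) hv hgraph

end ProximalNormalsOfClosedComplement

section Cones

theorem zero_mem_polarCone (B : Set E) : (0 : E) ∈ polarCone B := fun b _ => by
  rw [inner_zero_left]

theorem neg_polarCone (B : Set E) : -polarCone B = polarCone (-B) := by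
  ext u
  refine ⟨fun hu b hb => ?_, fun hu b hb => ?_⟩
  · simpa using hu (-b) hb
  · simpa using hu (-b) (by simpa using hb)

theorem convex_polarCone (B : Set E) : Convex ℝ (polarCone B) := by
  intro u hu v hv α β hα hβ _ b hb
  rw [inner_add_left, real_inner_smul_left, real_inner_smul_left]
  exact add_nonpos (mul_nonpos_of_nonneg_of_nonpos hα (hu b hb))
    (mul_nonpos_of_nonneg_of_nonpos hβ (hv b hb))

theorem coneHull_convexHull_subset_polarCone {B C : Set E} (hC : C ⊆ polarCone B) :
    coneHull (convexHull ℝ C) ⊆ polarCone B := by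
  rintro _ ⟨t, ht, c, hc, rfl⟩ b hb
  rw [real_inner_smul_left]
  exact mul_nonpos_of_nonneg_of_nonpos ht (convexHull_min hC (convex_polarCone B) hc b hb)

theorem coneHull_mono {B C : Set E} (h : B ⊆ C) : coneHull B ⊆ coneHull C :=
  fun _ ⟨t, ht, b, hb, hv⟩ => ⟨t, ht, b, h hb, hv⟩

theorem mem_tangentCone_of_eventually {A : Set E} {x w : E} (hw : w ≠ 0)
    (h : ∀ᶠ t in 𝓝[>] (0 : ℝ), x + t • w ∈ A) : w ∈ tangentCone A x := by
  obtain ⟨t, ht, hmem⟩ := exists_seq_forall_of_frequently (h.and self_mem_nhdsWithin).frequently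
  have hpos : ∀ n, 0 < t n := fun n => (hmem n).2
  refine ⟨‖w‖, norm_nonneg w, NormedSpace.normalize w,
    ⟨fun n => x + t n • w, fun n => ⟨(hmem n).1, by simp [hw, (hpos n).ne']⟩, ?_, ?_⟩,
    (NormedSpace.norm_smul_normalize w).symm⟩
  · simpa using ((tendsto_nhds_of_tendsto_nhdsWithin ht).smul_const w).const_add x
  · refine tendsto_const_nhds.congr fun n => ?_
    rw [add_sub_cancel_left]
    exact (NormedSpace.normalize_smul_of_pos (hpos n) w).symm

theorem exists_inner_neg_of_span_eq_top [FiniteDimensional ℝ E] {B : Set E}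
    (hB : Submodule.span ℝ B = ⊤) : ∃ e : E, ∀ n ∈ polarCone B, n ≠ 0 → inner ℝ n e < 0 := by
  obtain ⟨s, hsB, hs⟩ := (Submodule.fg_span_iff_fg_span_finset_subset B).1
    (IsNoetherian.noetherian (Submodule.span ℝ B))
  refine ⟨∑ v ∈ s, v, fun n hn hn0 => ?_⟩
  have hle : ∀ v ∈ s, inner ℝ n v ≤ 0 := fun v hv => hn v (hsB hv)
  rw [inner_sum]
  refine lt_of_le_of_ne (Finset.sum_nonpos hle) fun hsum => hn0 ?_
  have hker : Submodule.span ℝ (s : Set E) ≤ LinearMap.ker (innerₛₗ ℝ n) :=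
    Submodule.span_le.2 ((Finset.sum_eq_zero_iff_of_nonpos hle).1 hsum)
  rw [← hs, hB] at hker
  exact inner_self_eq_zero.1 (hker (Submodule.mem_top (x := n)))

theorem isCompact_convexHull [FiniteDimensional ℝ E] {K : Set E} (hK : IsCompact K) :
    IsCompact (convexHull ℝ K) := by
  have hC (k : ℕ) : IsCompact (stdSimplex ℝ (Fin k) ×ˢ Set.univ.pi fun _ : Fin k => K) :=
    (isCompact_stdSimplex ℝ (Fin k)).prod (isCompact_univ_pi fun _ => hK)
  suffices hunion : convexHull ℝ K = ⋃ k : Fin (Module.finrank ℝ E + 2),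
      (fun wz : (Fin k → ℝ) × (Fin k → E) => ∑ i, wz.1 i • wz.2 i) ''
        (stdSimplex ℝ (Fin k) ×ˢ Set.univ.pi fun _ => K) by
    rw [hunion]
    exact isCompact_iUnion fun k => (hC k).image (by fun_prop)
  refine Set.Subset.antisymm (fun v hv => ?_) (Set.iUnion_subset fun k => ?_)
  · obtain ⟨ι, _, z, w, hz, hind, hw, hw1, rfl⟩ := eq_pos_convex_span_of_mem_convexHull hv
    have hcard : Fintype.card ι < Module.finrank ℝ E + 2 :=
      Nat.lt_succ_of_le (hind.card_le_finrank_succ.trans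
        (Nat.succ_le_succ (Submodule.finrank_le _)))
    let e := (Fintype.equivFin ι).symm
    refine Set.mem_iUnion.2 ⟨⟨Fintype.card ι, hcard⟩, (w ∘ e, z ∘ e),
      ⟨⟨fun i => (hw _).le, (e.sum_comp w).trans hw1⟩, fun i _ => hz ⟨_, rfl⟩⟩, ?_⟩
    exact e.sum_comp fun i => w i • z i
  · rintro _ ⟨⟨w, z⟩, ⟨⟨hw, hw1⟩, hz⟩, rfl⟩
    exact (convex_convexHull ℝ K).sum_mem (fun i _ => hw i) hw1
      fun i _ => subset_convexHull ℝ K (hz i trivial)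

theorem exists_forall_inner_neg_of_zero_notMem_convexHull [FiniteDimensional ℝ E] {K : Set E}
    (hK : IsCompact K) (h0 : (0 : E) ∉ convexHull ℝ K) : ∃ w, ∀ v ∈ K, inner ℝ v w < 0 := by
  obtain ⟨f, c, hf0, hf⟩ := geometric_hahn_banach_point_closed (convex_convexHull ℝ K)
    (isCompact_convexHull hK).isClosed h0
  rw [map_zero] at hf0
  refine ⟨-(InnerProductSpace.toDual ℝ E).symm f, fun v hv => ?_⟩
  rw [inner_neg_right, real_inner_comm, InnerProductSpace.toDual_symm_apply]
  linarith [hf v (subset_convexHull ℝ K hv)]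

theorem exists_inner_pos_of_notMem_coneHull_convexHull [FiniteDimensional ℝ E] {K : Set E}
    (hK : IsCompact K) (hne : K.Nonempty) (h0 : (0 : E) ∉ convexHull ℝ K) {u : E}
    (hu : u ∉ coneHull (convexHull ℝ K)) : ∃ w, 0 < inner ℝ u w ∧ ∀ v ∈ K, inner ℝ v w < 0 := by
  have hzero : (0 : E) ∉ convexHull ℝ (insert (-u) K) := by
    rw [convexHull_insert hne, mem_convexJoin]
    rintro ⟨v, rfl, k, hk, α, β, hα, hβ, hαβ, hsum⟩
    rcases hα.eq_or_lt with rfl | hα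
    · obtain rfl : β = 1 := by linarith
      rw [zero_smul, zero_add, one_smul] at hsum
      exact h0 (hsum ▸ hk)
    · refine hu ⟨α⁻¹ * β, by positivity, k, hk, ?_⟩
      have hsmul : α • u = β • k := by
        rwa [smul_neg, neg_add_eq_zero] at hsum
      rw [mul_smul, ← hsmul, smul_smul, inv_mul_cancel₀ hα.ne', one_smul]
  obtain ⟨w, hw⟩ := exists_forall_inner_neg_of_zero_notMem_convexHull (hK.insert (-u)) hzero
  refine ⟨w, ?_, fun v hv => hw v (Set.mem_insert_of_mem _ hv)⟩
  simpa using hw (-u) (Set.mem_insert _ _)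

end Cones

section NormalCone

variable {X : Set E} {x : E}

theorem neg_mem_tangentCone_closedCompl (hx : x ∈ closure (closure X)ᶜ) {w : E} (hw : w ≠ 0)
    (h : IsHypertangent (closure X) x w) : -w ∈ tangentCone (closedCompl X) x :=
  mem_tangentCone_of_eventually (neg_ne_zero.2 hw) <|
    (h.compl_neg.eventually_mem_closure hx).mono fun _ ht =>
      closure_minimal compl_closure_subset_closedCompl isClosed_closure ht

theorem normalConeOfCompl_subset_coneHull_convexHull [FiniteDimensional ℝ E]
    (hx : x ∈ frontier (closure X))
    (h0 : (0 : E) ∉ convexHull ℝ (unitLimitingNormals (closure X) x)) :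
    normalConeOfCompl X x ⊆ coneHull (convexHull ℝ (unitLimitingNormals (closure X) x)) := by
  intro u hu
  by_contra hnot
  obtain ⟨w, huw, hw⟩ := exists_inner_pos_of_notMem_coneHull_convexHull
    isCompact_unitLimitingNormals
    (nonempty_unitLimitingNormals_of_mem_frontier isClosed_closure hx) h0 hnot
  have hw0 : w ≠ 0 := fun h => by simp [h] at huw
  have htan : -w ∈ tangentCone (closedCompl X) x :=
    neg_mem_tangentCone_closedCompl (frontier_eq_closure_inter_closure.subset hx).2 hw0
      (isHypertangent_of_forall_inner_neg isClosed_closure hw)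
  have hle : inner ℝ (-u) (-w) ≤ 0 := hu (-w) htan
  rw [inner_neg_neg] at hle
  exact hle.not_gt huw

theorem unitLimitingNormals_closure_subset_normalConeOfCompl [ProperSpace E]
    (hX : X ⊆ closure (interior X)) {r : ℝ} (hr0 : 0 < r)
    (hr : UniqueProjWithin (closedCompl X) r) :
    unitLimitingNormals (closure X) x ⊆ normalConeOfCompl X x := fun _ hv =>
  hr.unitLimitingNormals_subset_normalCone isClosed_closure hr0
    (neg_mem_unitLimitingNormals_closedCompl hX hr0 hr hv)

theorem mem_frontier_closure_of_isHypertangent_closedCompl (hX : X ⊆ closure (interior X))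
    (hx : x ∈ frontier (closedCompl X)) {e : E} (he : IsHypertangent (closedCompl X) x e) :
    x ∈ frontier (closure X) := by
  have hxcompl : x ∈ closure (closure X)ᶜ :=
    interior_closedCompl hX ▸ he.mem_closure_interior (isClosed_closure.frontier_subset hx)
  have hxX := closure_mono interior_subset (mem_closure_interior_of_mem_frontier_closedCompl hx)
  exact frontier_eq_closure_inter_closure.superset ⟨subset_closure hxX, hxcompl⟩

theorem clarkeGradient_infDist_eq_of_mem_frontier_closedCompl [ProperSpace E]
    (hx : x ∈ frontier (closedCompl X)) :
    clarkeGradient (fun y => infDist y X) x =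
      convexHull ℝ (insert 0 (unitLimitingNormals (closure X) x)) := by
  simp only [← infDist_closure (s := X)]
  exact clarkeGradient_infDist_eq isClosed_closure
    (closure_mono (interior_mono subset_closure)
      (mem_closure_interior_of_mem_frontier_closedCompl hx))

theorem zero_notMem_convexHull_of_forall_inner_pos {K : Set E} {e : E}
    (he : ∀ v ∈ K, 0 < inner ℝ v e) : (0 : E) ∉ convexHull ℝ K := fun h => by
  have hconv : Convex ℝ {v : E | 0 < inner ℝ v e} :=
    convex_halfSpace_gt (f := fun v => inner ℝ v e)
      ⟨fun v w => inner_add_left v w e, fun c v => real_inner_smul_left v e c⟩ 0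
  have hpos : (0 : ℝ) < inner ℝ 0 e := convexHull_min he hconv h
  rw [inner_zero_left] at hpos
  exact hpos.false

end NormalCone

end NormalClarke

open NormalClarke

theorem mainTheorem7_general {E : Type*} [NormedAddCommGroup E] [InnerProductSpace ℝ E]
    [FiniteDimensional ℝ E] {X : Set E} (hX : X ⊆ closure (interior X))
    (hreach : 0 < reach (closedCompl X)) {x : E} (hx : x ∈ frontier (closedCompl X))
    (hfull : Submodule.span ℝ (tangentCone (closedCompl X) x) = ⊤) :
    normalConeOfCompl X x = coneHull (clarkeGradient (fun y => Metric.infDist y X) x) := by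
  have hA : IsClosed (closedCompl X) := isClosed_closure
  obtain ⟨r, hr0, hr⟩ := exists_uniqueProjWithin_of_reach_pos ⟨x, hA.frontier_subset hx⟩ hreach
  obtain ⟨e, he⟩ := exists_inner_neg_of_span_eq_top hfull
  have hN : unitLimitingNormals (closure X) x ⊆ normalConeOfCompl X x :=
    unitLimitingNormals_closure_subset_normalConeOfCompl hX hr0 hr
  have hfrontier : x ∈ frontier (closure X) :=
    mem_frontier_closure_of_isHypertangent_closedCompl hX hx <|
      isHypertangent_of_forall_inner_neg hA fun v hv =>
        he v (hr.unitLimitingNormals_subset_normalCone hA hr0 hv)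
          (ne_zero_of_mem_unitLimitingNormals hv)
  have h0 : (0 : E) ∉ convexHull ℝ (unitLimitingNormals (closure X) x) :=
    zero_notMem_convexHull_of_forall_inner_pos (e := e) fun v hv => by
      simpa using he (-v) (hN hv) (neg_ne_zero.2 (ne_zero_of_mem_unitLimitingNormals hv))
  rw [clarkeGradient_infDist_eq_of_mem_frontier_closedCompl hx]
  refine Set.Subset.antisymm ?_ ?_
  · exact (normalConeOfCompl_subset_coneHull_convexHull hfrontier h0).trans
      (coneHull_mono (convexHull_mono (Set.subset_insert _ _)))
  · rw [normalConeOfCompl, normalCone, neg_polarCone] at hN ⊢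
    exact coneHull_convexHull_subset_polarCone (Set.insert_subset (zero_mem_polarCone _) hN)

theorem mainTheorem7 (d : ℕ) (X : Set (EuclideanSpace ℝ (Fin d)))
    (hX : X ⊆ closure (interior X))
    (hreach : 0 < NormalClarke.reach (NormalClarke.closedCompl X))
    (hfull : NormalClarke.FullyDimensional (NormalClarke.closedCompl X))
    (x : EuclideanSpace ℝ (Fin d)) (hx : x ∈ frontier (NormalClarke.closedCompl X)) :
    NormalClarke.normalConeOfCompl X x =
      NormalClarke.coneHull
        (NormalClarke.clarkeGradient (fun y => Metric.infDist y X) x) :=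
  mainTheorem7_general hX hreach hx (Submodule.eq_top_of_finrank_eq (hfull x hx))
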